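/- For a finite group $G$, let $B(G)$ be its Burnside ring (the Grothendieck ring of finite $G$-sets under disjoint union and cartesian product), and for a subgroup $U\leqslant G$ let $x\mapsto |x^U|$ be the ring homomorphism $B(G)\to\mathbb Z$ with $[X]\mapsto |X^U|$. For a normal subgroup $N$ of $G$, the deflation $\mathrm{Def}^G_{G/N}:B(G)\to B(G/N)$ is the additive map that sends the class of a finite $G$-set $X$ to the class of the $G/N$-set of $N$-orbits on $X$. If $C$ is a cyclic group of order $|G|$, the Frobenius–Wielandt (FW) morphism $\alpha^G:B(C)\to B(G)$ is the unique ring homomorphism such that $|\alpha^G(x)^U|=|x^{C_U}|$ for all $x\in B(C)$ and $U\leqslant G$, where $C_U$ denotes the subgroup of $C$ of order $|U|$. For a normal subgroup $K$ of a finite group $L$, put $$m_{L,K}=\frac1{|L|}\sum_{X\leqslant L,\ XK=L}|X|\,\mu(X,L),$$ where $\mu$ is the Möbius function of the poset of subgroups of $L$. Let $G$ be a finite group, let $p$ be a prime, and suppose that $G$ has a unique subgroup $N$ of order $p$ and that $N$ is central in $G$. Let $C$ be a cyclic group of order $|G|$. If $m_{T,N}=m_{C_T,C_N}$ for every subgroup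 $T$ of $G$ containing $N$, then the FW morphism commutes with $\mathrm{Def}^G_{G/N}$, that is, $$\mathrm{Def}^G_{G/N}\circ\alpha^G=\alpha^{G/N}\circ\mathrm{Def}^C_{C/C_N}$$ as maps $B(C)\to B(G/N)$, where $\alpha^{G/N}:B(C/C_N)\to B(G/N)$ is the FW morphism of $G/N$, taken with respect to the cyclic group $C/C_N$ of order $|G/N|$. -/

import Mathlib

universe u v

/-! ### Finite `G`-sets and the Burnside ring -/

/-- A finite left `G`-set. -/
structure FinGSet (G : Type u) [Group G] : Type (u + 1) where
  carrier : Type u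
  [action : MulAction G carrier]
  [finite : Finite carrier]

attribute [instance] FinGSet.action FinGSet.finite

namespace FinGSet

variable {G : Type u} [Group G]

/-- Two `G`-sets are isomorphic if there is a `G`-equivariant bijection between them. -/
def Iso (X Y : FinGSet G) : Prop :=
  ∃ e : X.carrier ≃ Y.carrier, ∀ (g : G) (x : X.carrier), e (g • x) = g • e x

/-- The relation of being isomorphic, on finite `G`-sets. -/
instance isoSetoid (G : Type u) [Group G] : Setoid (FinGSet G) where
  r := Iso
  iseqv :=
    { refl := fun _ => ⟨Equiv.refl _, fun _ _ => rfl⟩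
      symm := fun {_ _} ⟨e, he⟩ =>
        ⟨e.symm, fun g y => by rw [Equiv.symm_apply_eq, he, Equiv.apply_symm_apply]⟩
      trans := fun {_ _ _} ⟨e, he⟩ ⟨f, hf⟩ =>
        ⟨e.trans f, fun g x => by simp [he, hf]⟩ }

/-- The disjoint union of two finite `G`-sets. -/
def sum (X Y : FinGSet G) : FinGSet G := ⟨X.carrier ⊕ Y.carrier⟩

/-- The cartesian product of two finite `G`-sets, with the diagonal action. -/
def prod (X Y : FinGSet G) : FinGSet G := ⟨X.carrier × Y.carrier⟩

/-- The one-point `G`-set. -/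
def point (G : Type u) [Group G] : FinGSet G :=
  letI : MulAction G PUnit.{u + 1} :=
    { smul := fun _ x => x, one_smul := fun _ => rfl, mul_smul := fun _ _ _ => rfl }
  ⟨PUnit.{u + 1}⟩

/-- The number of points of `X` that are fixed by the subgroup `U`. -/
noncomputable def numFixed (U : Subgroup G) (X : FinGSet G) : ℕ :=
  Nat.card {x : X.carrier // ∀ g ∈ U, g • x = x}

end FinGSet

/-- Isomorphism classes of finite `G`-sets. -/
def GSetClass (G : Type u) [Group G] : Type (u + 1) :=
  Quotient (FinGSet.isoSetoid G)

namespace GSetClass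

variable {G : Type u} [Group G]

/-- The isomorphism class of a finite `G`-set. -/
def mk (X : FinGSet G) : GSetClass G := Quotient.mk _ X

/-- An isomorphism invariant of finite `G`-sets, as a function of the isomorphism class. -/
def lift {A : Type v} (f : FinGSet G → A) (hiso : ∀ X Y, X.Iso Y → f X = f Y) :
    GSetClass G → A :=
  Quotient.lift f hiso

/-- Isomorphism classes of finite `G`-sets form a commutative monoid under cartesian product. -/
instance : CommMonoid (GSetClass G) where
  mul := Quotient.map₂ FinGSet.prod (by
    rintro X X' ⟨e, he⟩ Y Y' ⟨f, hf⟩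
    exact ⟨Equiv.prodCongr e f, fun g x => Prod.ext (he g x.1) (hf g x.2)⟩)
  one := mk (FinGSet.point G)
  mul_assoc := by
    rintro ⟨X⟩ ⟨Y⟩ ⟨Z⟩
    exact Quotient.sound ⟨Equiv.prodAssoc _ _ _, fun _ _ => rfl⟩
  mul_comm := by
    rintro ⟨X⟩ ⟨Y⟩
    exact Quotient.sound ⟨Equiv.prodComm _ _, fun _ _ => rfl⟩
  one_mul := by
    rintro ⟨X⟩
    exact Quotient.sound ⟨Equiv.punitProd _, fun _ _ => rfl⟩
  mul_one := by
    rintro ⟨X⟩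
    exact Quotient.sound ⟨Equiv.prodPUnit _, fun _ _ => rfl⟩

end GSetClass

/-- The ideal of the additivity relations `[X ⊔ Y] - [X] - [Y]` in the free abelian group on the
isomorphism classes of finite `G`-sets, which is a ring with `[X] * [Y] = [X × Y]`. -/
def burnsideRel (G : Type u) [Group G] : Ideal (FreeAbelianGroup (GSetClass G)) :=
  Ideal.span {z | ∃ X Y : FinGSet G, z =
    FreeAbelianGroup.of (GSetClass.mk (X.sum Y)) - FreeAbelianGroup.of (GSetClass.mk X)
      - FreeAbelianGroup.of (GSetClass.mk Y)}

/-- The Burnside ring `B(G)`: the Grothendieck ring of finite `G`-sets with respect to disjoint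
union and cartesian product. -/
def BurnsideRing (G : Type u) [Group G] : Type (u + 1) :=
  FreeAbelianGroup (GSetClass G) ⧸ burnsideRel G

namespace BurnsideRing

noncomputable instance (G : Type u) [Group G] : CommRing (BurnsideRing G) :=
  inferInstanceAs (CommRing (FreeAbelianGroup (GSetClass G) ⧸ burnsideRel G))

variable {G : Type u} [Group G]

/-- The class `[X]` in the Burnside ring of a finite `G`-set `X`. -/
noncomputable def cls (X : Type u) [MulAction G X] [Finite X] : BurnsideRing G :=
  Ideal.Quotient.mk (burnsideRel G) (FreeAbelianGroup.of (GSetClass.mk ⟨X⟩))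

theorem lift_mul_rel {A : Type v} [AddCommGroup A] (f : FinGSet G → A)
    (hiso : ∀ X Y, X.Iso Y → f X = f Y) (hsum : ∀ X Y, f (X.sum Y) = f X + f Y)
    (z : FreeAbelianGroup (GSetClass G)) (hz : z ∈ burnsideRel G) :
    ∀ r : FreeAbelianGroup (GSetClass G),
      FreeAbelianGroup.lift (GSetClass.lift f hiso) (r * z) = 0 := by
  refine Submodule.span_induction
    (p := fun z _ => ∀ r : FreeAbelianGroup (GSetClass G),
      FreeAbelianGroup.lift (GSetClass.lift f hiso) (r * z) = 0) ?_ ?_ ?_ ?_ hz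
  · rintro _ ⟨X, Y, rfl⟩ r
    induction r using FreeAbelianGroup.induction_on with
    | zero => rw [zero_mul, map_zero]
    | of c =>
      obtain ⟨Z, rfl⟩ : ∃ Z, c = GSetClass.mk Z := ⟨Quotient.out c, (Quotient.out_eq c).symm⟩
      rw [mul_sub, mul_sub, FreeAbelianGroup.of_mul_of, FreeAbelianGroup.of_mul_of,
        FreeAbelianGroup.of_mul_of, map_sub, map_sub, FreeAbelianGroup.lift_apply_of,
        FreeAbelianGroup.lift_apply_of, FreeAbelianGroup.lift_apply_of]
      change f (Z.prod (X.sum Y)) - f (Z.prod X) - f (Z.prod Y) = 0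
      rw [hiso (Z.prod (X.sum Y)) ((Z.prod X).sum (Z.prod Y))
        ⟨Equiv.prodSumDistrib _ _ _, by rintro g ⟨z, x | y⟩ <;> rfl⟩, hsum]
      abel
    | neg c hc => rw [neg_mul, map_neg, hc, neg_zero]
    | add a b ha hb => rw [add_mul, map_add, ha, hb, add_zero]
  · intro r
    rw [mul_zero, map_zero]
  · intro x y _ _ hx hy r
    rw [mul_add, map_add, hx, hy, add_zero]
  · intro a x _ hx r
    rw [smul_eq_mul, ← mul_assoc, hx]

/-- The extension to the Burnside ring of an additive invariant of finite `G`-sets. -/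
noncomputable def liftAdd {A : Type v} [AddCommGroup A] (f : FinGSet G → A)
    (hiso : ∀ X Y, X.Iso Y → f X = f Y) (hsum : ∀ X Y, f (X.sum Y) = f X + f Y) :
    BurnsideRing G →+ A :=
  QuotientAddGroup.lift (burnsideRel G).toAddSubgroup
    (FreeAbelianGroup.lift (GSetClass.lift f hiso))
    (fun z hz => by simpa using lift_mul_rel f hiso hsum z hz 1)

theorem liftAdd_cls {A : Type v} [AddCommGroup A] (f : FinGSet G → A)
    (hiso : ∀ X Y, X.Iso Y → f X = f Y) (hsum : ∀ X Y, f (X.sum Y) = f X + f Y)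
    (X : Type u) [MulAction G X] [Finite X] :
    liftAdd f hiso hsum (cls X) = f ⟨X⟩ :=
  FreeAbelianGroup.lift_apply_of _ _

theorem cls_congr {X Y : Type u} [MulAction G X] [Finite X] [MulAction G Y] [Finite Y]
    (e : X ≃ Y) (he : ∀ (g : G) (x : X), e (g • x) = g • e x) :
    (cls X : BurnsideRing G) = cls Y :=
  congrArg (fun c => Ideal.Quotient.mk (burnsideRel G) (FreeAbelianGroup.of c))
    (Quotient.sound (s := FinGSet.isoSetoid G) ⟨e, he⟩)

theorem cls_sum (X Y : Type u) [MulAction G X] [Finite X] [MulAction G Y] [Finite Y] :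
    (cls (X ⊕ Y) : BurnsideRing G) = cls X + cls Y := by
  have h := Ideal.Quotient.eq_zero_iff_mem.2 (Ideal.subset_span (α := FreeAbelianGroup _)
    ⟨⟨X⟩, ⟨Y⟩, rfl⟩ : _ ∈ burnsideRel G)
  rw [map_sub, map_sub, sub_sub, sub_eq_zero] at h
  exact h

theorem cls_prod (X Y : Type u) [MulAction G X] [Finite X] [MulAction G Y] [Finite Y] :
    (cls (X × Y) : BurnsideRing G) = cls X * cls Y :=
  congrArg (Ideal.Quotient.mk (burnsideRel G))
    (FreeAbelianGroup.of_mul_of (GSetClass.mk ⟨X⟩) (GSetClass.mk ⟨Y⟩)).symm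

theorem cls_point : (cls (FinGSet.point G).carrier : BurnsideRing G) = 1 := rfl

theorem induction {p : BurnsideRing G → Prop}
    (hcls : ∀ (X : Type u) [MulAction G X] [Finite X], p (cls X))
    (hneg : ∀ a, p a → p (-a)) (hadd : ∀ a b, p a → p b → p (a + b)) (a : BurnsideRing G) :
    p a := by
  have h1 := hcls (FinGSet.point G).carrier
  have hzero : p 0 := by simpa using hadd _ _ h1 (hneg _ h1)
  obtain ⟨z, rfl⟩ := Ideal.Quotient.mk_surjective a
  induction z using FreeAbelianGroup.induction_on with
  | zero => exact hzero
  | of c =>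
    obtain ⟨Z, rfl⟩ : ∃ Z, c = GSetClass.mk Z := ⟨Quotient.out c, (Quotient.out_eq c).symm⟩
    exact hcls Z.carrier
  | neg c hc => exact hneg _ hc
  | add a b ha hb => exact hadd _ _ ha hb

end BurnsideRing

namespace FinGSet

variable {G : Type u} [Group G]

theorem numFixed_iso (U : Subgroup G) {X Y : FinGSet G} (h : X.Iso Y) :
    X.numFixed U = Y.numFixed U := by
  obtain ⟨e, he⟩ := h
  refine Nat.card_congr (e.subtypeEquiv fun x => forall₂_congr fun g _ => ?_)
  rw [← he, e.apply_eq_iff_eq]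

theorem numFixed_sum (U : Subgroup G) (X Y : FinGSet G) :
    (X.sum Y).numFixed U = X.numFixed U + Y.numFixed U := by
  unfold numFixed
  rw [← Nat.card_sum]
  refine Nat.card_congr (Equiv.subtypeSum.trans (Equiv.sumCongr ?_ ?_))
  · exact Equiv.subtypeEquivRight fun x => forall₂_congr fun g _ => Sum.inl_injective.eq_iff
  · exact Equiv.subtypeEquivRight fun x => forall₂_congr fun g _ => Sum.inr_injective.eq_iff

theorem numFixed_prod (U : Subgroup G) (X Y : FinGSet G) :
    (X.prod Y).numFixed U = X.numFixed U * Y.numFixed U := by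
  unfold numFixed
  rw [← Nat.card_prod]
  refine Nat.card_congr ((Equiv.subtypeEquivRight fun x => ?_).trans Equiv.subtypeProdEquivProd)
  exact ⟨fun h => ⟨fun g hg => congrArg Prod.fst (h g hg), fun g hg => congrArg Prod.snd (h g hg)⟩,
    fun h g hg => Prod.ext (h.1 g hg) (h.2 g hg)⟩

theorem numFixed_point (U : Subgroup G) : (point G).numFixed U = 1 := by
  refine (Nat.card_congr (Equiv.subtypeUnivEquiv fun x => ?_)).trans
    (Nat.card_unique (α := PUnit.{u + 1}))
  exact fun g _ => rfl

end FinGSet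

namespace BurnsideRing

variable {G : Type u} [Group G]

/-- The fixed point map `x ↦ |x ^ U|` as an additive map. -/
noncomputable def markAdd (U : Subgroup G) : BurnsideRing G →+ ℤ :=
  liftAdd (fun X => (X.numFixed U : ℤ))
    (fun _ _ h => congrArg Nat.cast (FinGSet.numFixed_iso U h))
    (fun X Y => by rw [FinGSet.numFixed_sum, Nat.cast_add])

/-- The ring homomorphism of fixed points `B(G) → ℤ`, `x ↦ |x ^ U|`, extending
`[X] ↦ |X ^ U|`. -/
noncomputable def mark (U : Subgroup G) : BurnsideRing G →+* ℤ :=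
  { markAdd U with
    map_one' := by
      change markAdd U 1 = 1
      rw [← cls_point, markAdd, liftAdd_cls]
      exact congrArg Nat.cast (FinGSet.numFixed_point U)
    map_mul' := by
      change ∀ a b, markAdd U (a * b) = markAdd U a * markAdd U b
      intro a b
      induction a using induction with
      | hcls X =>
        induction b using induction with
        | hcls Y =>
          rw [← cls_prod, markAdd, liftAdd_cls, liftAdd_cls, liftAdd_cls, ← Nat.cast_mul]
          exact congrArg Nat.cast (FinGSet.numFixed_prod U ⟨X⟩ ⟨Y⟩)
        | hneg b hb => rw [mul_neg, map_neg, map_neg, hb, mul_neg]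
        | hadd b c hb hc => rw [mul_add, map_add, map_add, hb, hc, mul_add]
      | hneg a ha => rw [neg_mul, map_neg, map_neg, ha, neg_mul]
      | hadd a c ha hc => rw [add_mul, map_add, map_add, ha, hc, add_mul] }

theorem mark_cls (U : Subgroup G) (X : Type u) [MulAction G X] [Finite X] :
    mark U (cls X : BurnsideRing G) = Nat.card {x : X // ∀ g ∈ U, g • x = x} := by
  exact liftAdd_cls (fun X => (X.numFixed U : ℤ))
    (fun _ _ h => congrArg Nat.cast (FinGSet.numFixed_iso U h))
    (fun X Y => by rw [FinGSet.numFixed_sum, Nat.cast_add]) X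

end BurnsideRing

/-! ### Deflation -/

/-- The set of orbits of a normal subgroup `N` of `G` on the `G`-set `X`, i.e. the quotient of `X`
by the relation `x ∼ n • x` for `n ∈ N`. -/
def NOrbits {G : Type u} [Group G] (N : Subgroup G) (X : Type u) [MulAction G X] : Type u :=
  MulAction.orbitRel.Quotient N X

namespace NOrbits

variable {G : Type u} [Group G] (N : Subgroup G) {X Y : Type u} [MulAction G X] [MulAction G Y]

/-- The orbit `N x`. -/
def mk (x : X) : NOrbits N X := Quotient.mk _ x

theorem mk_eq_mk {x y : X} : mk N x = mk N y ↔ ∃ n ∈ N, n • y = x := by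
  refine Quotient.eq.trans (MulAction.orbitRel_apply.trans ?_)
  exact ⟨fun ⟨n, hn⟩ => ⟨n, n.2, hn⟩, fun ⟨n, hn, h⟩ => ⟨⟨n, hn⟩, h⟩⟩

instance [Finite X] : Finite (NOrbits N X) := Quotient.finite _

/-- `G / N` acts on the `N`-orbits by `(g N) • (N x) = N (g • x)`. -/
instance [N.Normal] : MulAction (G ⧸ N) (NOrbits N X) where
  smul := Quotient.map₂ (fun (g : G) (x : X) => g • x) (by
    rintro g g' hg x x' ⟨n, rfl⟩
    rw [← Quotient.eq_iff_equiv, Quotient.eq, QuotientGroup.leftRel_apply] at hg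
    have hN : N.Normal := inferInstance
    refine Quotient.exact (s := MulAction.orbitRel N X) ((mk_eq_mk N).2 ⟨?_, ?_, ?_⟩)
    · exact g * (n * (g⁻¹ * g')⁻¹) * g⁻¹
    · exact hN.conj_mem _ (N.mul_mem n.2 (N.inv_mem hg)) g
    · change _ = g • (n : G) • x'
      rw [smul_smul, smul_smul]
      congr 1
      group)
  one_smul := by
    rintro ⟨x⟩
    exact congrArg (mk N) (one_smul G x)
  mul_smul := by
    rintro ⟨g⟩ ⟨h⟩ ⟨x⟩
    exact congrArg (mk N) (mul_smul g h x)

theorem smul_mk [N.Normal] (g : G) (x : X) :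
    (QuotientGroup.mk g : G ⧸ N) • mk N x = mk N (g • x) := rfl

/-- The orbits on a disjoint union. -/
def sumEquiv : NOrbits N (X ⊕ Y) ≃ NOrbits N X ⊕ NOrbits N Y where
  toFun := Quotient.lift (Sum.elim (fun x => Sum.inl (mk N x)) (fun y => Sum.inr (mk N y))) (by
    rintro a b h
    obtain ⟨n, hn, rfl⟩ := (mk_eq_mk N).1 (Quotient.sound h)
    rcases b with b | b
    · exact congrArg Sum.inl ((mk_eq_mk N).2 ⟨n, hn, rfl⟩)
    · exact congrArg Sum.inr ((mk_eq_mk N).2 ⟨n, hn, rfl⟩))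
  invFun := Sum.elim
    (Quotient.lift (fun x => mk N (Sum.inl x)) (by
      rintro a b h
      obtain ⟨n, hn, rfl⟩ := (mk_eq_mk N).1 (Quotient.sound h)
      exact (mk_eq_mk N).2 ⟨n, hn, rfl⟩))
    (Quotient.lift (fun x => mk N (Sum.inr x)) (by
      rintro a b h
      obtain ⟨n, hn, rfl⟩ := (mk_eq_mk N).1 (Quotient.sound h)
      exact (mk_eq_mk N).2 ⟨n, hn, rfl⟩))
  left_inv := by rintro ⟨x | y⟩ <;> rfl
  right_inv := by
    rintro (x | x)
    · induction x using Quotient.ind with | _ x => rfl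
    · induction x using Quotient.ind with | _ x => rfl

end NOrbits

namespace BurnsideRing

variable {G : Type u} [Group G]

/-- The deflation `Def : B(G) → B(G / N)`, the additive map sending the class of a finite `G`-set
`X` to the class of the `G / N`-set of `N`-orbits on `X`. -/
noncomputable def deflation (N : Subgroup G) [N.Normal] :
    BurnsideRing G →+ BurnsideRing (G ⧸ N) :=
  liftAdd (fun X => cls (NOrbits N X.carrier))
    (fun X Y ⟨e, he⟩ => cls_congr
      (Quotient.congr e fun x y => by
        refine Quotient.eq.symm.trans (((NOrbits.mk_eq_mk N).trans ?_).trans Quotient.eq)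
        refine Iff.trans ?_ (NOrbits.mk_eq_mk N).symm
        refine exists_congr fun n => and_congr_right fun _ => ?_
        rw [← he, e.apply_eq_iff_eq])
      (by
        rintro ⟨g⟩ ⟨x⟩
        exact congrArg (NOrbits.mk N) (he g x)))
    (fun X Y => by
      rw [← cls_sum]
      refine cls_congr (NOrbits.sumEquiv N) ?_
      rintro ⟨g⟩ ⟨x | y⟩ <;> rfl)

theorem deflation_cls (N : Subgroup G) [N.Normal] (X : Type u) [MulAction G X] [Finite X] :
    deflation N (cls X) = cls (NOrbits N X) :=
  liftAdd_cls _ _ _ _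

end BurnsideRing

/-! ### The Frobenius-Wielandt morphism -/

namespace BurnsideRing

section Marks

variable {G : Type u} [Group G]

/-- The orbit of a point, as a `G`-set. -/
def orbitSub {X : Type u} [MulAction G X] (x : X) : SubMulAction G X :=
  ⟨MulAction.orbit G x, by
    rintro g _ ⟨h, rfl⟩
    exact ⟨g * h, mul_smul g h x⟩⟩

theorem cls_split (X : Type u) [MulAction G X] [Finite X] (S : SubMulAction G X) :
    (cls X : BurnsideRing G) = cls S + cls (Sᶜ : SubMulAction G X) := by
  classical
  rw [← cls_sum]
  symm
  refine cls_congr (Equiv.Set.sumCompl (S : Set X)) ?_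
  rintro g (x | x) <;> rfl

theorem card_split (X : Type u) [MulAction G X] [Finite X] (S : SubMulAction G X) :
    Nat.card X = Nat.card S + Nat.card (Sᶜ : SubMulAction G X) := by
  classical
  rw [← Nat.card_sum]
  exact (Nat.card_congr (Equiv.Set.sumCompl (S : Set X))).symm

theorem card_compl_orbitSub_lt (X : Type u) [MulAction G X] [Finite X] (x : X) :
    Nat.card ((orbitSub (G := G) x)ᶜ : SubMulAction G X) < Nat.card X := by
  rw [card_split X (orbitSub (G := G) x)]
  have : Nonempty (orbitSub (G := G) x) := ⟨⟨x, MulAction.mem_orbit_self x⟩⟩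
  have := Nat.card_pos (α := orbitSub (G := G) x)
  omega

theorem cls_orbitSub [Finite G] (X : Type u) [MulAction G X] [Finite X] (x : X) :
    (cls (orbitSub x : SubMulAction G X) : BurnsideRing G) =
      cls (G ⧸ MulAction.stabilizer G x) := by
  symm
  refine cls_congr (MulAction.orbitEquivQuotientStabilizer G x).symm ?_
  rintro g ⟨h⟩
  refine Subtype.ext ?_
  exact mul_smul g h x

theorem cls_eq_zero (X : Type u) [MulAction G X] [Finite X] [IsEmpty X] :
    (cls X : BurnsideRing G) = 0 := by
  have h := cls_sum (G := G) X X
  rw [cls_congr (G := G) (Equiv.sumEmpty X X) (by rintro g (x | x) <;> exact isEmptyElim x)] at h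
  simpa using h

/-- Burnside's theorem: a finite `G`-set is determined by its numbers of fixed points. -/
theorem cls_eq_of_mark [Finite G] (n : ℕ) : ∀ (X Y : Type u) [MulAction G X] [Finite X]
    [MulAction G Y] [Finite Y], Nat.card X = n →
    (∀ U : Subgroup G, mark U (cls X) = mark U (cls Y)) →
    (cls X : BurnsideRing G) = cls Y := by
  induction n using Nat.strong_induction_on with
  | _ n ih =>
  intro X Y _ _ _ _ hn h
  have key : ∀ (Z W : Type u) [MulAction G Z] [Finite Z] [MulAction G W] [Finite W],
      (∀ U : Subgroup G, mark U (cls Z) = mark U (cls W)) → ∀ z : Z, ∃ w : W,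
        MulAction.stabilizer G z ≤ MulAction.stabilizer G w := by
    intro Z W _ _ _ _ h z
    have h1 := h (MulAction.stabilizer G z)
    rw [mark_cls, mark_cls, Nat.cast_inj] at h1
    have h2 : Nonempty {x : Z // ∀ g ∈ MulAction.stabilizer G z, g • x = x} :=
      ⟨⟨z, fun g hg => hg⟩⟩
    have h3 := Nat.card_pos (α := {x : Z // ∀ g ∈ MulAction.stabilizer G z, g • x = x})
    rw [h1] at h3
    obtain ⟨⟨w, hw⟩⟩ := (Nat.card_pos_iff.1 h3).1
    exact ⟨w, fun g hg => hw g hg⟩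
  rcases isEmpty_or_nonempty X with hX | hX
  · have hY : IsEmpty Y := ⟨fun y => by
      obtain ⟨x, _⟩ := key Y X (fun U => (h U).symm) y
      exact hX.elim x⟩
    rw [cls_eq_zero, cls_eq_zero]
  · obtain ⟨x, hx⟩ := Finite.exists_max (fun x : X => Nat.card (MulAction.stabilizer G x))
    obtain ⟨y, hy⟩ := key X Y h x
    obtain ⟨x', hx'⟩ := key Y X (fun U => (h U).symm) y
    have hxy : MulAction.stabilizer G x = MulAction.stabilizer G y := by
      refine Subgroup.eq_of_le_of_card_ge hy ?_
      exact (Subgroup.card_le_of_le hx').trans (hx x')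
    have horb : (cls (orbitSub x : SubMulAction G X) : BurnsideRing G) =
        cls (orbitSub y : SubMulAction G Y) := by
      rw [cls_orbitSub, cls_orbitSub, hxy]
    rw [cls_split X (orbitSub x), cls_split Y (orbitSub y), horb]
    congr 1
    refine ih _ (hn ▸ card_compl_orbitSub_lt (G := G) X x) _ _ rfl fun U => ?_
    have hU := h U
    rw [cls_split X (orbitSub x), cls_split Y (orbitSub y), map_add, map_add, horb] at hU
    exact add_left_cancel hU

theorem exists_eq_sub (a : BurnsideRing G) : ∃ X Y : FinGSet G,
    a = cls X.carrier - cls Y.carrier := by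
  induction a using induction with
  | hcls X =>
    exact ⟨FinGSet.sum ⟨X⟩ ⟨X⟩, ⟨X⟩, by
      rw [eq_sub_iff_add_eq]
      exact (cls_sum X X).symm⟩
  | hneg a ha =>
    obtain ⟨X, Y, rfl⟩ := ha
    exact ⟨Y, X, neg_sub _ _⟩
  | hadd a b ha hb =>
    obtain ⟨X, Y, rfl⟩ := ha
    obtain ⟨Z, W, rfl⟩ := hb
    refine ⟨X.sum Z, Y.sum W, ?_⟩
    have h1 : (cls (X.sum Z).carrier : BurnsideRing G) = _ := cls_sum X.carrier Z.carrier
    have h2 : (cls (Y.sum W).carrier : BurnsideRing G) = _ := cls_sum Y.carrier W.carrier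
    rw [h1, h2]
    abel

/-- Elements of the Burnside ring are determined by their numbers of fixed points. -/
theorem mark_ext [Finite G] {a b : BurnsideRing G} (h : ∀ U : Subgroup G, mark U a = mark U b) :
    a = b := by
  obtain ⟨X, Y, rfl⟩ := exists_eq_sub a
  obtain ⟨Z, W, rfl⟩ := exists_eq_sub b
  rw [sub_eq_sub_iff_add_eq_add, ← cls_sum, ← cls_sum]
  refine cls_eq_of_mark _ _ _ rfl fun U => ?_
  have := h U
  rw [map_sub, map_sub, sub_eq_sub_iff_add_eq_add] at this
  rw [cls_sum, cls_sum, map_add, map_add, this]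

end Marks

section FrobeniusWielandt

/-- The `G`-set of the `d`-element subsets of `G`, with the action by left translation. -/
def SubsetsOfCard (G : Type u) (d : ℕ) : Type u := {s : Set G // Nat.card s = d}

open scoped Pointwise in
instance (G : Type u) [Group G] (d : ℕ) : MulAction G (SubsetsOfCard G d) where
  smul g s := ⟨g • s.1, (Nat.card_congr (Equiv.Set.image _ s.1 (MulAction.injective g))).symm.trans
    s.2⟩
  one_smul s := Subtype.ext (one_smul G s.1)
  mul_smul g h s := Subtype.ext (mul_smul g h s.1)

instance (G : Type u) [Finite G] (d : ℕ) : Finite (SubsetsOfCard G d) :=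
  inferInstanceAs (Finite {s : Set G // Nat.card s = d})

open scoped Pointwise in
theorem mark_subsetsOfCard {G : Type u} [Group G] [Finite G] (d : ℕ) (U : Subgroup G) :
    mark U (cls (SubsetsOfCard G d)) =
      Nat.card {A : Set (G ⧸ U) // Nat.card U * Nat.card A = d} := by
  have hcard : ∀ A : Set (G ⧸ U),
      Nat.card {g : G | (QuotientGroup.mk g⁻¹ : G ⧸ U) ∈ A} = Nat.card U * Nat.card A := by
    intro A
    rw [← Nat.card_prod, ← Nat.card_congr (QuotientGroup.preimageMkEquivSubgroupProdSet U A)]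
    exact Nat.card_congr ((Equiv.inv G).subtypeEquiv fun g => Iff.rfl)
  rw [mark_cls, Nat.cast_inj]
  symm
  refine Nat.card_eq_of_bijective
    (fun A => ⟨⟨{g : G | (QuotientGroup.mk g⁻¹ : G ⧸ U) ∈ A.1}, (hcard A.1).trans A.2⟩, ?_⟩) ⟨?_, ?_⟩
  · intro u hu
    refine Subtype.ext (Set.ext fun g => ?_)
    change g ∈ u • {g : G | (QuotientGroup.mk g⁻¹ : G ⧸ U) ∈ A.1} ↔ _
    rw [Set.mem_smul_set_iff_inv_smul_mem]
    change (QuotientGroup.mk (u⁻¹ * g)⁻¹ : G ⧸ U) ∈ A.1 ↔ (QuotientGroup.mk g⁻¹ : G ⧸ U) ∈ A.1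
    rw [mul_inv_rev, inv_inv, QuotientGroup.mk_mul_of_mem _ hu]
  · intro A B h
    refine Subtype.ext (Set.ext fun q => ?_)
    obtain ⟨g, rfl⟩ := QuotientGroup.mk_surjective q
    have := Set.ext_iff.1 (congrArg (fun s => s.1.1) h) g⁻¹
    simpa using this
  · rintro ⟨⟨s, hs⟩, hU⟩
    have hU' : ∀ u ∈ U, ∀ g ∈ s, u * g ∈ s := by
      intro u hu g hg
      have h1 : u • s = s := congrArg Subtype.val (hU u hu)
      rw [← h1]
      exact Set.smul_mem_smul_set hg
    have hs' : {g : G | (QuotientGroup.mk g⁻¹ : G ⧸ U) ∈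
        ((fun g : G => (QuotientGroup.mk g⁻¹ : G ⧸ U)) '' s)} = s := by
      ext g
      constructor
      · rintro ⟨a, ha, hag⟩
        have h1 := QuotientGroup.eq.1 hag
        rw [inv_inv] at h1
        simpa using hU' _ (U.inv_mem h1) a ha
      · intro hg
        exact ⟨g, hg, rfl⟩
    refine ⟨⟨(fun g : G => (QuotientGroup.mk g⁻¹ : G ⧸ U)) '' s, ?_⟩, ?_⟩
    · rw [← hcard, hs', hs]
    · exact Subtype.ext (Subtype.ext hs')

variable {C : Type v} [CommGroup C] {G : Type u} [Group G]

/-- `y ∈ B(G)` has as many `U`-fixed points as `x ∈ B(C)` has `C_{|U|}`-fixed points, for all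
subgroups `U` of `G`, where `C_{|U|}` is the subgroup of order `|U|` of the cyclic group `C`. -/
def SameMarks (x : BurnsideRing C) (y : BurnsideRing G) : Prop :=
  ∀ (U : Subgroup G) (D : Subgroup C), Nat.card D = Nat.card U → mark U y = mark D x

theorem sameMarks_subsetsOfCard [Finite C] [Finite G] (h : Nat.card C = Nat.card G) (d : ℕ) :
    SameMarks (C := C) (cls (SubsetsOfCard C d)) (cls (SubsetsOfCard G d) : BurnsideRing G) := by
  intro U D hDU
  rw [mark_subsetsOfCard, mark_subsetsOfCard, Nat.cast_inj]
  have hq : Nat.card (G ⧸ U) = Nat.card (C ⧸ D) := by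
    rw [Subgroup.card_eq_card_quotient_mul_card_subgroup D,
      Subgroup.card_eq_card_quotient_mul_card_subgroup U, hDU] at h
    exact (Nat.eq_of_mul_eq_mul_right Nat.card_pos h).symm
  obtain ⟨e⟩ : Nonempty ((G ⧸ U) ≃ (C ⧸ D)) := 
    ⟨(Finite.equivFin _).trans ((finCongr hq).trans (Finite.equivFin _).symm)⟩
  refine Nat.card_congr ((Equiv.Set.congr e).subtypeEquiv fun A => ?_)
  rw [hDU]
  refine Eq.congr_left (congrArg _ ?_)
  exact Nat.card_congr (e.image A)

theorem cyclic_subgroup_unique [Finite C] [IsCyclic C] {D E : Subgroup C}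
    (h : Nat.card D = Nat.card E) : D = E := by
  have key : ∀ D : Subgroup C, D = (powMonoidHom (Nat.card D) : C →* C).ker := by
    intro D
    refine Subgroup.eq_of_le_of_card_ge (fun x hx => ?_) ?_
    · exact congrArg Subtype.val (pow_card_eq_one' (x := (⟨x, hx⟩ : D)))
    · rw [IsCyclic.card_powMonoidHom_ker]
      exact Nat.gcd_le_right _ Nat.card_pos
  rw [key D, key E, h]

theorem exists_sameMarks_of_stabilizers [Finite C] (n : ℕ) : ∀ (X : Type v) [MulAction C X]
    [Finite X], Nat.card X = n →
    (∀ x : X, ∃ y : BurnsideRing G, SameMarks (C := C) (cls (C ⧸ MulAction.stabilizer C x)) y) →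
    ∃ y : BurnsideRing G, SameMarks (C := C) (cls X) y := by
  induction n using Nat.strong_induction_on with
  | _ n ih =>
  intro X _ _ hn h
  rcases isEmpty_or_nonempty X with hX | ⟨⟨x⟩⟩
  · refine ⟨0, fun U D _ => ?_⟩
    rw [cls_eq_zero, map_zero, map_zero]
  · obtain ⟨y, hy⟩ := h x
    obtain ⟨z, hz⟩ := ih _ (hn ▸ card_compl_orbitSub_lt (G := C) X x) _ rfl (fun w => by
      have : MulAction.stabilizer C w = MulAction.stabilizer C (w : X) := by
        ext g
        exact Subtype.ext_iff
      rw [this]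
      exact h w)
    refine ⟨y + z, fun U D hD => ?_⟩
    rw [cls_split X (orbitSub x), cls_orbitSub, map_add, map_add, hy U D hD, hz U D hD]

open scoped Pointwise in
theorem exists_sameMarks_quotient [Finite C] [IsCyclic C] [Finite G]
    (h : Nat.card C = Nat.card G) (d : ℕ) : ∀ D : Subgroup C, Nat.card D = d →
    ∃ y : BurnsideRing G, SameMarks (C := C) (cls (C ⧸ D)) y := by
  induction d using Nat.strong_induction_on with
  | _ d ih =>
  intro D hD
  have hd : 0 < d := hD ▸ Nat.card_pos
  let x : SubsetsOfCard C d := ⟨(D : Set C), hD⟩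
  have hx : MulAction.stabilizer C x = D := by
    ext g
    refine (Subtype.ext_iff (a1 := g • x) (a2 := x)).trans ?_
    change g • (D : Set C) = (D : Set C) ↔ _
    constructor
    · intro hg
      have h1 : g • (1 : C) ∈ g • (D : Set C) := Set.smul_mem_smul_set D.one_mem
      rw [hg] at h1
      simpa using h1
    · intro hg
      exact smul_coe_set hg
  obtain ⟨z, hz⟩ := exists_sameMarks_of_stabilizers (G := G) _
    ((orbitSub (G := C) x)ᶜ : SubMulAction C (SubsetsOfCard C d)) rfl (by
      rintro ⟨⟨s, hs⟩, hsx⟩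
      have hst : ∀ g ∈ MulAction.stabilizer C
          (⟨⟨s, hs⟩, hsx⟩ : ((orbitSub (G := C) x)ᶜ : SubMulAction C (SubsetsOfCard C d))), g • s = s :=
        fun g hg => congrArg (fun t => t.1.1) hg
      set E := MulAction.stabilizer C
          (⟨⟨s, hs⟩, hsx⟩ : ((orbitSub (G := C) x)ᶜ : SubMulAction C (SubsetsOfCard C d)))
      obtain ⟨a, ha⟩ : s.Nonempty := by
        rw [Set.nonempty_iff_ne_empty]
        rintro rfl
        simp at hs
        omega
      have hsub : a • (E : Set C) ⊆ s := by
        rintro _ ⟨g, hg, rfl⟩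
        rw [← hst g hg]
        change a * g ∈ _
        rw [mul_comm]
        exact Set.smul_mem_smul_set ha
      have hcard : Nat.card (a • (E : Set C) : Set C) = Nat.card E :=
        (Nat.card_congr (Equiv.Set.image _ (E : Set C) (MulAction.injective a))).symm
      have hle : Nat.card E ≤ d := by
        rw [← hcard, ← hs]
        exact Nat.card_mono s.toFinite hsub
      rcases hle.lt_or_eq with hlt | heq
      · exact ih _ hlt E rfl
      · exfalso
        refine hsx ⟨a, Subtype.ext ?_⟩
        change a • (D : Set C) = s
        rw [cyclic_subgroup_unique (hD.trans heq.symm)]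
        refine Set.eq_of_subset_of_ncard_le hsub ?_
        rw [← Nat.card_coe_set_eq, ← Nat.card_coe_set_eq, hcard, heq, hs])
  refine ⟨cls (SubsetsOfCard G d) - z, fun U E hE => ?_⟩
  have h1 := sameMarks_subsetsOfCard h d U E hE
  rw [map_sub, h1, cls_split (SubsetsOfCard C d) (orbitSub x), cls_orbitSub, hx, map_add,
    hz U E hE, add_sub_cancel_right]

theorem exists_sameMarks [IsCyclic C] [Finite G] (h : Nat.card C = Nat.card G)
    (x : BurnsideRing C) : ∃ y : BurnsideRing G, SameMarks x y := by
  have : Finite C := Nat.finite_of_card_ne_zero (h ▸ Nat.card_pos.ne')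
  induction x using induction with
  | hcls X =>
    exact exists_sameMarks_of_stabilizers _ X rfl
      fun x => exists_sameMarks_quotient h _ _ rfl
  | hneg a ha =>
    obtain ⟨y, hy⟩ := ha
    exact ⟨-y, fun U D hD => by rw [map_neg, map_neg, hy U D hD]⟩
  | hadd a b ha hb =>
    obtain ⟨y, hy⟩ := ha
    obtain ⟨z, hz⟩ := hb
    exact ⟨y + z, fun U D hD => by rw [map_add, map_add, hy U D hD, hz U D hD]⟩

theorem exists_subgroup_card [IsCyclic C] [Finite G] (h : Nat.card C = Nat.card G)
    (U : Subgroup G) : ∃ D : Subgroup C, Nat.card D = Nat.card U := by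
  have : Finite C := Nat.finite_of_card_ne_zero (h ▸ Nat.card_pos.ne')
  refine ⟨(powMonoidHom (Nat.card U) : C →* C).ker, ?_⟩
  rw [IsCyclic.card_powMonoidHom_ker, h]
  exact Nat.gcd_eq_right U.card_subgroup_dvd_card

theorem SameMarks.unique [IsCyclic C] [Finite G] (h : Nat.card C = Nat.card G)
    {x : BurnsideRing C} {y z : BurnsideRing G} (hy : SameMarks x y) (hz : SameMarks x z) :
    y = z := by
  refine mark_ext fun U => ?_
  obtain ⟨D, hD⟩ := exists_subgroup_card h U
  rw [hy U D hD, hz U D hD]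

/-- The Frobenius-Wielandt morphism `α : B(C) → B(G)`, for a finite group `G` and a cyclic group
`C` of order `|G|`: the ring homomorphism for which `|α(x) ^ U| = |x ^ C_{|U|}|` for every subgroup
`U` of `G` and every `x ∈ B(C)`, where `C_{|U|}` is the subgroup of order `|U|` of `C`
(see `mark_fwHom`). -/
noncomputable def fwHom [IsCyclic C] [Finite G] (h : Nat.card C = Nat.card G) :
    BurnsideRing C →+* BurnsideRing G where
  toFun x := (exists_sameMarks h x).choose
  map_one' := SameMarks.unique h (exists_sameMarks h 1).choose_spec
    fun U D _ => by rw [map_one, map_one]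
  map_mul' x y := SameMarks.unique h (exists_sameMarks h (x * y)).choose_spec
    fun U D hD => by
      rw [map_mul, map_mul, (exists_sameMarks h x).choose_spec U D hD,
        (exists_sameMarks h y).choose_spec U D hD]
  map_zero' := SameMarks.unique h (exists_sameMarks h 0).choose_spec
    fun U D _ => by rw [map_zero, map_zero]
  map_add' x y := SameMarks.unique h (exists_sameMarks h (x + y)).choose_spec
    fun U D hD => by
      rw [map_add, map_add, (exists_sameMarks h x).choose_spec U D hD,
        (exists_sameMarks h y).choose_spec U D hD]

theorem mark_fwHom [IsCyclic C] [Finite G] (h : Nat.card C = Nat.card G) (x : BurnsideRing C)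
    (U : Subgroup G) (D : Subgroup C) (hD : Nat.card D = Nat.card U) :
    mark U (fwHom h x) = mark D x :=
  (exists_sameMarks h x).choose_spec U D hD

end FrobeniusWielandt

end BurnsideRing

/-! ### The constants `m_{L, K}` -/

open Classical in
/-- The Möbius function `μ(X, Y)` of the poset of subgroups of a finite group `L`. -/
noncomputable def subgroupMu (L : Type u) [Group L] [Finite L] (X Y : Subgroup L) : ℚ :=
  letI : Fintype (Subgroup L) := Fintype.ofFinite _
  letI : LocallyFiniteOrder (Subgroup L) := Fintype.toLocallyFiniteOrder
  IncidenceAlgebra.mu ℚ X Y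

open scoped Pointwise Classical in
/-- The constant `m_{L, K} = (1 / |L|) ∑_{X K = L} |X| μ(X, L)`, for a normal subgroup `K` of a
finite group `L`, where `X` runs over the subgroups of `L` and `μ` is the Möbius function of the
poset of subgroups of `L`. -/
noncomputable def deflationConst (L : Type u) [Group L] [Finite L] (K : Subgroup L) : ℚ :=
  letI : Fintype (Subgroup L) := Fintype.ofFinite _
  1 / (Nat.card L : ℚ) *
    ∑ X ∈ Finset.univ.filter fun X : Subgroup L => (X : Set L) * (K : Set L) = Set.univ,
      (Nat.card X : ℚ) * subgroupMu L X ⊤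

/-! ### Quotients of equal order -/

instance isCyclic_quotient_subgroup {C : Type v} [CommGroup C] [IsCyclic C] (D : Subgroup C) :
    IsCyclic (C ⧸ D) :=
  isCyclic_of_surjective (QuotientGroup.mk' D) (QuotientGroup.mk'_surjective D)

theorem card_quotient_eq {C : Type v} [Group C] {G : Type u} [Group G] [Finite G]
    (h : Nat.card C = Nat.card G) {D : Subgroup C} {N : Subgroup G}
    (hD : Nat.card D = Nat.card N) : Nat.card (C ⧸ D) = Nat.card (G ⧸ N) := by
  rw [Subgroup.card_eq_card_quotient_mul_card_subgroup D,
    Subgroup.card_eq_card_quotient_mul_card_subgroup N, hD] at h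
  exact Nat.eq_of_mul_eq_mul_right Nat.card_pos h

namespace BurnsideRing

/-! ### `N`-orbits stable under a subgroup of `G / N`, and marks at orders divisible by `p`. -/

section FixedOrbits

/-! Elements of a Burnside ring are determined by their marks, so it is enough to express the marks
of a deflation through marks upstairs by formulas involving subgroup orders only. Let `U ≤ G / N`
have preimage `T`. The orbit `N x` is fixed by `U` iff `T x ⊆ N x`. If moreover `N` does not fix
`x`, then `N` acts freely on this orbit, and `T ∩ Stab x` is a complement of `N` in `T`, of order
`|U|`.

If `p ∣ |U|`, such a complement would contain a subgroup of order `p`, hence `N` itself, which is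
absurd. So the stable orbits are the single points of `X ^ T`, and `|Def(y) ^ U| = |y ^ T|`
(`mark_deflation_of_dvd`).

If `p ∤ |U|`, Schur–Zassenhaus gives a complement `S` of `N` in `T`. As `N` is central, `S` is the
only subgroup of its order in `T`, so the stable orbits are exactly the `N`-orbits on `X ^ S`. Orbit
counting gives `p |Def(y) ^ U| = |y ^ S| + (p - 1) |y ^ T|` (`mark_deflation_of_not_dvd`).

Both formulas hold for `C` and `CN` as well, with subgroups of the same orders, and the FW morphism
matches marks at equal orders. -/

theorem le_of_prime_dvd_card {G : Type u} [Group G] [Finite G] {N : Subgroup G} {p : ℕ} (hp : p.Prime)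
    (huniq : ∀ H : Subgroup G, Nat.card H = p → H = N) {S : Subgroup G} (h : p ∣ Nat.card S) :
    N ≤ S := by
  have : Fact p.Prime := ⟨hp⟩
  obtain ⟨s, hs⟩ := exists_prime_orderOf_dvd_card' (G := S) p h
  rw [← huniq (Subgroup.zpowers (s : G)) (by rw [Nat.card_zpowers, Subgroup.orderOf_coe, hs]),
    Subgroup.zpowers_le]
  exact s.2

variable {G : Type u} [Group G] (N : Subgroup G) [N.Normal]

theorem smul_mk_eq_iff {X : Type u} [MulAction G X] (U : Subgroup (G ⧸ N)) (x : X) :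
    (∀ u ∈ U, u • NOrbits.mk N x = NOrbits.mk N x) ↔
      ∀ t ∈ U.comap (QuotientGroup.mk' N), ∃ n ∈ N, n • x = t • x := by
  constructor
  · intro h t ht
    exact (NOrbits.mk_eq_mk N).1 (h _ ht)
  · intro h u hu
    obtain ⟨t, rfl⟩ := QuotientGroup.mk_surjective u
    exact (NOrbits.mk_eq_mk N).2 (h t hu)

theorem card_comap_mk [Finite G] (U : Subgroup (G ⧸ N)) :
    Nat.card (U.comap (QuotientGroup.mk' N)) = Nat.card U * Nat.card N := by
  have h := Subgroup.card_eq_card_quotient_mul_card_subgroup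
    (N.subgroupOf (U.comap (QuotientGroup.mk' N)))
  have hle : N ≤ U.comap (QuotientGroup.mk' N) := by
    intro n hn
    rw [Subgroup.mem_comap, QuotientGroup.mk'_apply, (QuotientGroup.eq_one_iff n).2 hn]
    exact U.one_mem
  rw [Nat.card_congr (Subgroup.subgroupOfEquivOfLe hle).toEquiv] at h
  rw [h]
  congr 1
  -- The preimage of `⊥` is `N`, so the index of `N` in the preimage of `U` is the index of `⊥` in
  -- `U`, namely `|U|`.
  have := Subgroup.relIndex_comap (f := QuotientGroup.mk' N) (H := ⊥)
    (K := U.comap (QuotientGroup.mk' N))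
  rw [MonoidHom.comap_bot, QuotientGroup.ker_mk',
    Subgroup.map_comap_eq_self_of_surjective (QuotientGroup.mk'_surjective N),
    Subgroup.relIndex_bot_left] at this
  exact this

/-- If a subgroup `N` of prime order does not fix `x` but the `N`-orbit of `x` is stable under
`U ≤ G / N`, then the stabilizer of `x` in the preimage of `U` has order `|U|`. -/
theorem card_stabilizer_of_stable [Finite G] (hp : (Nat.card N).Prime) {X : Type u}
    [MulAction G X] (U : Subgroup (G ⧸ N)) (x : X)
    (hU : ∀ t ∈ U.comap (QuotientGroup.mk' N), ∃ n ∈ N, n • x = t • x)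
    (hN : ¬ N ≤ MulAction.stabilizer G x) :
    Nat.card (U.comap (QuotientGroup.mk' N) ⊓ MulAction.stabilizer G x : Subgroup G) =
      Nat.card U := by
  have hbot : N ⊓ MulAction.stabilizer G x = ⊥ := by
    have hdvd := Subgroup.card_dvd_of_le (inf_le_left : N ⊓ MulAction.stabilizer G x ≤ N)
    rcases (Nat.dvd_prime hp).1 hdvd with h | h
    · exact Subgroup.card_eq_one.1 h
    · exact absurd (inf_eq_left.1 (Subgroup.eq_of_le_of_card_ge inf_le_left h.ge)) hN
  refine Nat.card_eq_of_bijective (fun s => ⟨QuotientGroup.mk' N s.1, s.2.1⟩) ⟨?_, ?_⟩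
  · rintro ⟨s, hs⟩ ⟨t, ht⟩ h
    have h1 : s⁻¹ * t ∈ N := QuotientGroup.eq.1 (congrArg Subtype.val h)
    have h2 : s⁻¹ * t ∈ N ⊓ MulAction.stabilizer G x :=
      ⟨h1, Subgroup.mul_mem _ (Subgroup.inv_mem _ hs.2) ht.2⟩
    rw [hbot, Subgroup.mem_bot, inv_mul_eq_one] at h2
    exact Subtype.ext h2
  · rintro ⟨u, hu⟩
    obtain ⟨t, rfl⟩ := QuotientGroup.mk_surjective u
    obtain ⟨n, hn, h⟩ := hU t hu
    have hmk : QuotientGroup.mk' N (n⁻¹ * t) = QuotientGroup.mk' N t := by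
      rw [map_mul, QuotientGroup.mk'_apply, (QuotientGroup.eq_one_iff _).2 (N.inv_mem hn), one_mul]
    -- `t` moves `x` exactly as `n` does, so correcting `t` by `n⁻¹` gives a lift of the same class
    -- that fixes `x`.
    refine ⟨⟨n⁻¹ * t, ?_, ?_⟩, Subtype.ext hmk⟩
    · change QuotientGroup.mk' N (n⁻¹ * t) ∈ U
      rw [hmk]
      exact hu
    · change (n⁻¹ * t) • x = x
      rw [mul_smul, ← h, inv_smul_smul]

/-- A stable orbit on which `N` acts nontrivially would have a point stabilizer in the preimage of
order `|U|`. That order is divisible by `p`, so the stabilizer would contain `N`, a contradiction.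
Hence stable orbits are single points, and `x ↦ N x` is the required bijection. -/
theorem mark_deflation_of_dvd [Finite G] {p : ℕ} (hp : p.Prime) (hNp : Nat.card N = p)
    (huniq : ∀ H : Subgroup G, Nat.card H = p → H = N) (U : Subgroup (G ⧸ N))
    (hU : p ∣ Nat.card U) (y : BurnsideRing G) :
    mark U (deflation N y) = mark (U.comap (QuotientGroup.mk' N)) y := by
  induction y using induction with
  | hcls X =>
    rw [deflation_cls, mark_cls, mark_cls, Nat.cast_inj]
    have key : ∀ x : X, (∀ t ∈ U.comap (QuotientGroup.mk' N), ∃ n ∈ N, n • x = t • x) →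
        N ≤ MulAction.stabilizer G x := by
      intro x hx
      by_contra hN
      refine hN ((le_of_prime_dvd_card hp huniq ?_).trans
        (inf_le_right (a := U.comap (QuotientGroup.mk' N))))
      rwa [card_stabilizer_of_stable N (hNp ▸ hp) U x hx hN]
    symm
    refine Nat.card_eq_of_bijective (fun x => ⟨NOrbits.mk N x.1, (smul_mk_eq_iff N U x.1).2
      fun t ht => ⟨1, N.one_mem, by rw [one_smul, x.2 t ht]⟩⟩) ⟨?_, ?_⟩
    · rintro ⟨x, hx⟩ ⟨y, hy⟩ h
      obtain ⟨n, hn, h⟩ := (NOrbits.mk_eq_mk N).1 (congrArg Subtype.val h)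
      refine Subtype.ext (h.symm.trans (key y (fun t ht => ⟨1, N.one_mem, ?_⟩) hn))
      rw [one_smul, hy t ht]
    · rintro ⟨q, hq⟩
      obtain ⟨x, rfl⟩ : ∃ x, NOrbits.mk N x = q := Quotient.exists_rep q
      have hx := (smul_mk_eq_iff N U x).1 hq
      refine ⟨⟨x, fun t ht => ?_⟩, rfl⟩
      obtain ⟨n, hn, h⟩ := hx t ht
      rw [← h]
      exact key x hx hn
  | hneg a ha => rw [map_neg, map_neg, map_neg, ha]
  | hadd a b ha hb => rw [map_add, map_add, map_add, ha, hb]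

/-! ### Marks at orders prime to `p`: orbit counting and complements. -/

/-- The action of a central subgroup on the fixed points of a subgroup. -/
abbrev fixedPointsAction {N : Subgroup G} (hN : N ≤ Subgroup.center G) (S : Subgroup G)
    (X : Type u) [MulAction G X] : MulAction N {x : X // ∀ s ∈ S, s • x = x} where
  smul n x := ⟨(n : G) • x.1, fun s hs => by
    rw [smul_smul, Subgroup.mem_center_iff.1 (hN n.2) s, mul_smul, x.2 s hs]⟩
  one_smul x := Subtype.ext (one_smul G x.1)
  mul_smul m n x := Subtype.ext (mul_smul (m : G) (n : G) x.1)

/-- Burnside's orbit counting lemma for a central subgroup of prime order acting on the fixed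
points of a subgroup. -/
theorem card_orbits_mul_card [Finite G] {N : Subgroup G} (hN : N ≤ Subgroup.center G)
    (hp : (Nat.card N).Prime) (S : Subgroup G) (X : Type u) [MulAction G X] [Finite X] :
    letI := fixedPointsAction hN S X
    Nat.card (MulAction.orbitRel.Quotient N {x : X // ∀ s ∈ S, s • x = x}) * Nat.card N =
      Nat.card {x : X // ∀ s ∈ S, s • x = x} +
        (Nat.card N - 1) * Nat.card {x : X // ∀ s ∈ S ⊔ N, s • x = x} := by
  classical
  let := fixedPointsAction hN S X
  have := Fintype.ofFinite N
  have := Fintype.ofFinite {x : X // ∀ s ∈ S, s • x = x}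
  have := fun n : N => Fintype.ofFinite (MulAction.fixedBy {x : X // ∀ s ∈ S, s • x = x} n)
  have := Fintype.ofFinite (MulAction.orbitRel.Quotient N {x : X // ∀ s ∈ S, s • x = x})
  have h := MulAction.sum_card_fixedBy_eq_card_orbits_mul_card_group N
    {x : X // ∀ s ∈ S, s • x = x}
  have hone : Fintype.card (MulAction.fixedBy {x : X // ∀ s ∈ S, s • x = x} (1 : N)) =
      Nat.card {x : X // ∀ s ∈ S, s • x = x} := by
    rw [← Nat.card_eq_fintype_card]
    exact Nat.card_congr (Equiv.subtypeUnivEquiv fun x => one_smul N x)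
  -- Each of the `|N| - 1` nontrivial elements generates `N`, as `|N|` is prime, so a point of `X ^
  -- S` that it fixes is fixed by all of `S ⊔ N`.
  have hne : ∀ n ∈ (Finset.univ : Finset N).erase 1,
      Fintype.card (MulAction.fixedBy {x : X // ∀ s ∈ S, s • x = x} n) =
        Nat.card {x : X // ∀ s ∈ S ⊔ N, s • x = x} := by
    intro n hn
    have hn1 : n ≠ 1 := Finset.ne_of_mem_erase hn
    rw [← Nat.card_eq_fintype_card]
    have : Fact (Nat.card N).Prime := ⟨hp⟩
    have key : ∀ x : {x : X // ∀ s ∈ S, s • x = x}, n • x = x →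
        ∀ s ∈ S ⊔ N, s • x.1 = x.1 := by
      intro x hx
      change S ⊔ N ≤ MulAction.stabilizer G x.1
      refine sup_le x.2 fun m hm => ?_
      obtain ⟨k, hk⟩ := mem_zpowers_of_prime_card (p := Nat.card N) rfl hn1 (g' := ⟨m, hm⟩)
      have hk' : (n : G) ^ k = m := congrArg Subtype.val hk
      rw [← hk']
      exact Subgroup.zpow_mem _ (congrArg Subtype.val hx) k
    exact Nat.card_congr
      { toFun := fun x => ⟨x.1.1, key x.1 x.2⟩
        invFun := fun x => ⟨⟨x.1, fun s hs => x.2 s (le_sup_left (b := N) hs)⟩,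
          Subtype.ext (x.2 n (le_sup_right (a := S) n.2))⟩
        left_inv := fun _ => rfl
        right_inv := fun _ => rfl }
  rw [← Finset.add_sum_erase _ _ (Finset.mem_univ (1 : N)), hone, Finset.sum_congr rfl hne,
    Finset.sum_const, smul_eq_mul, Finset.card_erase_of_mem (Finset.mem_univ _),
    Finset.card_univ, ← Nat.card_eq_fintype_card, ← Nat.card_eq_fintype_card] at h
  exact h.symm

/-- An element of `S'` is `s * n` with `s` and `n` commuting. Raising it to the power `|S|` kills it
and `s`, hence `n`; as the order of `n` also divides `|N|`, coprimality forces `n = 1`. -/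
theorem eq_of_complement_central {N : Subgroup G} (hN : N ≤ Subgroup.center G)
    {S S' : Subgroup G} [Finite S] [Finite S'] (hcard : Nat.card S' = Nat.card S)
    (hcop : (Nat.card S).Coprime (Nat.card N)) (hle : S' ≤ S ⊔ N) : S' = S := by
  refine Subgroup.eq_of_le_of_card_ge (fun t ht => ?_) hcard.ge
  have : N.Normal := ⟨fun n hn g => by
    rw [Subgroup.mem_center_iff.1 (hN hn) g, mul_inv_cancel_right]
    exact hn⟩
  obtain ⟨s, hs, n, hn, rfl⟩ := Subgroup.mem_sup_of_normal_right.1 (hle ht)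
  have h1 : (s * n) ^ Nat.card S = 1 := by
    rw [← hcard]
    exact congrArg Subtype.val (pow_card_eq_one' (x := (⟨s * n, ht⟩ : S')))
  have h2 : s ^ Nat.card S = 1 := congrArg Subtype.val (pow_card_eq_one' (x := (⟨s, hs⟩ : S)))
  have h3 : n ^ Nat.card N = 1 := congrArg Subtype.val (pow_card_eq_one' (x := (⟨n, hn⟩ : N)))
  rw [(show Commute s n from Subgroup.mem_center_iff.1 (hN hn) s).mul_pow, h2, one_mul] at h1
  have h4 : n = 1 := by
    rw [← orderOf_eq_one_iff, ← Nat.dvd_one, ← hcop]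
    exact Nat.dvd_gcd (orderOf_dvd_of_pow_eq_one h1) (orderOf_dvd_of_pow_eq_one h3)
  rw [h4, mul_one]
  exact hs

/-- The `U`-fixed orbits are the `N`-orbits that meet the fixed points of `S`, and these are counted
by `card_orbits_mul_card`. The factor `p` stays on the left so that the identity lives in `ℤ` and is
additive in `y`. -/
theorem mark_deflation_of_not_dvd [Finite G] {p : ℕ} (hp : p.Prime) (hNp : Nat.card N = p)
    (hN : N ≤ Subgroup.center G) (U : Subgroup (G ⧸ N)) (hU : ¬ p ∣ Nat.card U)
    (S : Subgroup G) (hS : Nat.card S = Nat.card U)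
    (hSN : S ⊔ N = U.comap (QuotientGroup.mk' N)) (y : BurnsideRing G) :
    mark U (deflation N y) * p =
      mark S y + (p - 1 : ℕ) * mark (U.comap (QuotientGroup.mk' N)) y := by
  induction y using induction with
  | hcls X =>
    rw [deflation_cls, mark_cls, mark_cls, mark_cls]
    norm_cast
    let := fixedPointsAction hN S X
    have h := card_orbits_mul_card hN (hNp ▸ hp) S X
    rw [hNp, hSN] at h
    rw [← h]
    congr 1
    symm
    have hstable : ∀ x : X, (∀ s ∈ S, s • x = x) →
        ∀ u ∈ U, u • NOrbits.mk N x = NOrbits.mk N x := by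
      refine fun x hx => (smul_mk_eq_iff N U x).2 ?_
      rw [← hSN]
      intro t ht
      obtain ⟨n, hn, s, hs, rfl⟩ := Subgroup.mem_sup_of_normal_left.1 (sup_comm S N ▸ ht)
      exact ⟨n, hn, by rw [mul_smul, hx s hs]⟩
    -- The bijection sends an `N`-orbit inside `X ^ S` to the same orbit inside `X`.
    refine Nat.card_eq_of_bijective (Quotient.lift
      (fun x => ⟨NOrbits.mk N x.1, hstable x.1 x.2⟩) ?_) ⟨?_, ?_⟩
    · rintro x y ⟨n, h⟩
      exact Subtype.ext ((NOrbits.mk_eq_mk N).2 ⟨n, n.2, congrArg Subtype.val h⟩)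
    · rintro ⟨x⟩ ⟨y⟩ h
      obtain ⟨n, hn, h⟩ := (NOrbits.mk_eq_mk N).1 (congrArg Subtype.val h)
      exact Quotient.sound ⟨⟨n, hn⟩, Subtype.ext h⟩
    · rintro ⟨q, hq⟩
      obtain ⟨x, rfl⟩ : ∃ x, NOrbits.mk N x = q := Quotient.exists_rep q
      have hx := (smul_mk_eq_iff N U x).1 hq
      refine ⟨Quotient.mk _ ⟨x, ?_⟩, rfl⟩
      -- Either `N x` is a single point, fixed by the whole preimage, or the stabilizer of `x` in
      -- the preimage has order `|S|` and so equals `S`.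
      by_cases hNx : N ≤ MulAction.stabilizer G x
      · intro s hs
        obtain ⟨n, hn, h⟩ := hx s (hSN ▸ le_sup_left (b := N) hs)
        rw [← h]
        exact hNx hn
      · have hcop : (Nat.card S).Coprime (Nat.card N) := by
          rw [hS, hNp]
          exact ((Nat.Prime.coprime_iff_not_dvd hp).2 hU).symm
        have := eq_of_complement_central hN
          ((card_stabilizer_of_stable N (hNp ▸ hp) U x hx hNx).trans hS.symm) hcop
          (hSN ▸ inf_le_left)
        rw [← this]
        exact fun s hs => hs.2
  | hneg a ha => rw [map_neg, map_neg, map_neg, map_neg, neg_mul, ha]; ring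
  | hadd a b ha hb => rw [map_add, map_add, map_add, map_add, add_mul, ha, hb]; ring

/-- Schur–Zassenhaus inside the preimage `T`, where `N` is normal of index `|U|`; the complement is
then pushed forward to `G`. -/
theorem exists_complement_comap [Finite G] (U : Subgroup (G ⧸ N))
    (hU : (Nat.card N).Coprime (Nat.card U)) :
    ∃ S : Subgroup G, Nat.card S = Nat.card U ∧ S ⊔ N = U.comap (QuotientGroup.mk' N) := by
  set T := U.comap (QuotientGroup.mk' N) with hT
  have hle : N ≤ T := by
    intro n hn
    rw [hT, Subgroup.mem_comap, QuotientGroup.mk'_apply, (QuotientGroup.eq_one_iff n).2 hn]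
    exact U.one_mem
  have hN : Nat.card (N.subgroupOf T) = Nat.card N :=
    Nat.card_congr (Subgroup.subgroupOfEquivOfLe hle).toEquiv
  have hidx : (N.subgroupOf T).index = Nat.card U := by
    have h := (N.subgroupOf T).card_mul_index
    rw [hN, card_comap_mk, mul_comm] at h
    exact Nat.eq_of_mul_eq_mul_right Nat.card_pos h
  obtain ⟨H, hH⟩ := Subgroup.exists_left_complement'_of_coprime
    (N := N.subgroupOf T) (by rw [hN, hidx]; exact hU)
  refine ⟨H.map T.subtype, ?_, ?_⟩
  · rw [Subgroup.card_map_of_injective T.subtype_injective]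
    have h := hH.card_mul_card
    rw [hN, card_comap_mk] at h
    exact Nat.eq_of_mul_eq_mul_right Nat.card_pos h
  · have h := congrArg (Subgroup.map T.subtype) hH.sup_eq_top
    rw [Subgroup.map_sup, Subgroup.map_subgroupOf_eq_of_le hle] at h
    rw [h, ← MonoidHom.range_eq_map, Subgroup.range_subtype]

end FixedOrbits

end BurnsideRing

-- Comparison of the marks on both sides.

/- For `N` central and the only subgroup of order `p`, the numbers of fixed points of a deflation are
determined by those of the argument in a way that depends on subgroup orders only, so that the
equalities `m_{T, N} = m_{C_T, C_N}` hold automatically and the proof does not have to use `hm`. -/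
open BurnsideRing in
/-- Let `p` be a prime and let `N` be the unique subgroup of order `p` of the finite group `G`,
where `N` is central. Let `C` be a cyclic group of order `|G|` and `C_N` its subgroup of order `|N|`.
If `m_{T, N} = m_{C_T, C_N}` for every subgroup `T` of `G` containing `N`, where `C_T` is the
subgroup of order `|T|` of `C`, then `Def_{G/N} ∘ α^G = α^{G/N} ∘ Def_{C/C_N}`. -/
theorem mainTheorem5 {G : Type u} [Group G] [Finite G] {C : Type v} [CommGroup C] [IsCyclic C]
    [Finite C] (hC : Nat.card C = Nat.card G)
    (p : ℕ) (hp : p.Prime) (N : Subgroup G) [N.Normal] (hNp : Nat.card N = p)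
    (hNuniq : ∀ H : Subgroup G, Nat.card H = p → H = N) (hNcentral : N ≤ Subgroup.center G)
    (CN : Subgroup C) (hCN : Nat.card CN = Nat.card N)
    (hm : ∀ T : Subgroup G, N ≤ T → ∀ CT : Subgroup C, Nat.card CT = Nat.card T →
      deflationConst T (N.subgroupOf T) = deflationConst CT (CN.subgroupOf CT))
    (x : BurnsideRing C) :
    BurnsideRing.deflation N (BurnsideRing.fwHom hC x) =
      BurnsideRing.fwHom (card_quotient_eq hC hCN) (BurnsideRing.deflation CN x) := by
  refine mark_ext fun U => ?_
  obtain ⟨D, hD⟩ := exists_subgroup_card (card_quotient_eq hC hCN) U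
  rw [mark_fwHom _ _ U D hD]
  have hCp := hCN.trans hNp
  have hcard : Nat.card (D.comap (QuotientGroup.mk' CN)) =
      Nat.card (U.comap (QuotientGroup.mk' N)) := by
    rw [card_comap_mk, card_comap_mk, hD, hCN]
  -- As `|D| = |U|`, the same case applies to `U` in `G / N` and to `D` in `C / CN`.
  by_cases hU : p ∣ Nat.card U
  · rw [mark_deflation_of_dvd N hp hNp hNuniq U hU, mark_fwHom hC x _ _ hcard,
      mark_deflation_of_dvd CN hp hCp (fun H hH => cyclic_subgroup_unique (hH.trans hCp.symm)) D
        (hD ▸ hU)]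
  · have hcop := (Nat.Prime.coprime_iff_not_dvd hp).2 hU
    obtain ⟨S, hS, hSN⟩ := exists_complement_comap N U (hNp ▸ hcop)
    obtain ⟨E, hE, hEN⟩ := exists_complement_comap CN D (by rwa [hCp, hD])
    have hG := mark_deflation_of_not_dvd N hp hNp hNcentral U hU S hS hSN (fwHom hC x)
    have hC' := mark_deflation_of_not_dvd CN hp hCp
      (fun c _ => Subgroup.mem_center_iff.2 fun g => mul_comm g c) D (hD ▸ hU) E hE hEN x
    -- After transport to `C`, the two right-hand sides agree, so the marks agree up to the factor
    -- `p`, which cancels in `ℤ`.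
    rw [mark_fwHom hC x _ _ hcard, mark_fwHom hC x S E (hE.trans (hD.trans hS.symm)), ← hC'] at hG
    exact mul_right_cancel₀ (Nat.cast_ne_zero.2 hp.ne_zero) hG
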